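/- Let $p$ be a prime, let $s$ be a positive integer, and let $q=p^{2s}$. For $A\subset\mathbb{F}_q$ and $c\in\mathbb{F}_q$ put $$S(q,A;c)=\sum_{a\in A} e_p\big(\operatorname{Tr}_{\mathbb{F}_q/\mathbb{F}_p}(ac)\big),\qquad e_p(x)=e^{2\pi i x/p}\quad(x\in\mathbb{F}_p).$$ Let $A\subset\mathbb{F}_q$ be such that $0,1\in A$ and $|A|=\sqrt q=p^s$. Suppose that either - $p^s\equiv 1\pmod 4$ and $S(q,A;c)=0$ for every nonzero square $c\in\mathbb{F}_q^*$, or - $p^s\equiv 3\pmod 4$ and $S(q,A;c)=0$ for every non-square $c\in\mathbb{F}_q^*$. Then $A=\mathbb{F}_{\sqrt q}$, that is, $A$ is the subfield of $\mathbb{F}_q$ with $\sqrt q$ elements. -/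

import Mathlib

/-- The exponential sum `S(q, A; c) = ∑_{a ∈ A} e_p (Tr_{F/𝔽_p} (a c))` over a subset `A` of a finite
field `F` of characteristic `p`, with `e_p (x) = exp (2 π i x / p)` (this is `ZMod.stdAddChar`). -/
noncomputable def expSum (p : ℕ) [Fact p.Prime] {F : Type*} [Field F] [Algebra (ZMod p) F]
    (A : Finset F) (c : F) : ℂ :=
  ∑ a ∈ A, ZMod.stdAddChar (Algebra.trace (ZMod p) F (a * c))

/-! Write n = √q and let χ be the quadratic character. Evaluate ∑ χ(c)|S(c)|² in two ways. It equals
the Gauss sum times M = ∑ χ(a - b), and, as S is supported on 0 and one class of χ, Parseval gives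
±(n³ - n²). Since the Gauss sum squares to χ(-1)n², |M| = n² - n. So all differences lie in one
class, that of 1 - 0 (`isSquare_sub_of_sum_addChar_eq_zero`).

Blokhuis' argument then applies: Rédei polynomials kill the elementary symmetric functions e_j of A
for 0 < j ≤ n/2, and inverting A kills the remaining middle ones of A \ {0}. Hence ∏ (X + x) over A
\ {0} is X^(n-1) + const; as 1 ∈ A, every x ∈ A satisfies x^n = x (`pow_eq_self_of_isSquare_sub`).
-/

/-! ### Rédei polynomials and sets with square differences -/

open Finset Polynomial in
theorem exists_finset_pow_eq_neg_one {F : Type*} [Field F] [Fintype F] {m : ℕ} (hm : 0 < m)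
    (hdvd : 2 * m ∣ Fintype.card F - 1) :
    ∃ T : Finset F, #T = m ∧ ∀ u ∈ T, u ^ m = -1 := by
  classical
  obtain ⟨g, hg⟩ := IsCyclic.exists_generator (α := Fˣ)
  have hord : orderOf g = Fintype.card F - 1 := by
    rw [orderOf_eq_card_of_forall_mem_zpowers hg, Nat.card_eq_fintype_card, Fintype.card_units]
  have hprim : IsPrimitiveRoot (g : F) (Fintype.card F - 1) := by
    rw [← hord, ← orderOf_units]
    exact IsPrimitiveRoot.orderOf _
  obtain ⟨k, hk⟩ := hdvd
  have hpos : 0 < Fintype.card F - 1 := by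
    have := Fintype.one_lt_card (α := F)
    omega
  have h2m : IsPrimitiveRoot ((g : F) ^ k) (2 * m) := hprim.pow hpos (by rw [hk, mul_comm])
  have hζm : ((g : F) ^ k) ^ m = -1 :=
    (h2m.pow (by omega) (by rw [mul_comm])).eq_neg_one_of_two_right
  have hm' : IsPrimitiveRoot (((g : F) ^ k) ^ 2) m := h2m.pow (by omega) rfl
  refine ⟨⟨nthRoots m (-1), hm'.nthRoots_nodup (by simp)⟩, ?_, fun u hu => ?_⟩
  · rw [card_mk, hm'.card_nthRoots, if_pos ⟨_, hζm⟩]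
  · exact (mem_nthRoots hm).1 hu

open Finset Polynomial in
theorem prod_X_add_C_eq_of_injOn {F : Type*} [Field F] {n : ℕ} (hn : 1 < n) {c : F}
    {A : Finset F} (hA : #A = n) {f : F → F} (hinj : Set.InjOn f A)
    (hf : ∀ x ∈ A, (-f x) ^ n + c * (-f x) = 0) :
    ∏ x ∈ A, (X + C (f x)) = X ^ n + C c * X := by
  classical
  have hm1 : (∏ x ∈ A, (X + C (f x))).Monic := monic_prod_of_monic _ _ fun x _ => monic_X_add_C _
  have hd1 : (∏ x ∈ A, (X + C (f x))).natDegree = n := by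
    rw [natDegree_prod_of_monic _ _ fun x _ => monic_X_add_C _]
    simp [hA]
  have hlt : (C c * X : F[X]).degree < (n : ℕ) :=
    (degree_C_mul_X_le c).trans_lt (by exact_mod_cast hn)
  have hm2 : (X ^ n + C c * X : F[X]).Monic := monic_X_pow_add hlt
  have hd2 : (X ^ n + C c * X : F[X]).degree = n := by
    rw [degree_add_eq_left_of_degree_lt (by simpa using hlt), degree_X_pow]
  have hd1' : (∏ x ∈ A, (X + C (f x))).degree = ((n : ℕ) : WithBot ℕ) := by
    rw [degree_eq_natDegree hm1.ne_zero, hd1]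
  have hcard : #(A.image fun x => -f x) = n := by
    rw [card_image_of_injOn, hA]
    intro x hx y hy h
    exact hinj hx hy (neg_injective h)
  refine eq_of_degree_sub_lt_of_eval_finset_eq (A.image fun x => -f x) ?_ ?_
  · rw [hcard, ← hd1']
    exact degree_sub_lt_left (hd1'.trans hd2.symm) hm1.ne_zero (by rw [hm1.leadingCoeff, hm2.leadingCoeff])
  · intro y hy
    obtain ⟨x, hx, rfl⟩ := mem_image.1 hy
    rw [eval_prod, prod_eq_zero hx (by simp)]
    simpa using (hf x hx).symm

open Finset Polynomial in
/-- The coefficients of the Rédei polynomial of a set with square differences vanish. -/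
theorem sum_powersetCard_prod_eq_zero {F : Type*} [Field F] [Fintype F] {p s n : ℕ} [CharP F p]
    [Fact p.Prime] (hps : n = p ^ s) (hn : 1 < n) (hodd : Odd n) (hF : Fintype.card F = n ^ 2)
    {A : Finset F} (hA : #A = n) (hsq : ∀ x ∈ A, ∀ y ∈ A, IsSquare (x - y)) {j : ℕ}
    (hj : 0 < j) (hjn : j ≤ n / 2) :
    ∑ t ∈ A.powersetCard j, ∏ x ∈ t, x = 0 := by
  obtain ⟨k, hk⟩ := hodd
  have hF1 : Fintype.card F - 1 = (n - 1) * (n + 1) := by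
    rw [hF, mul_comm, ← Nat.sq_sub_sq, one_pow]
  have hm2 : 2 * (k + 1) = n + 1 := by omega
  obtain ⟨T, hT, hTu⟩ := exists_finset_pow_eq_neg_one (F := F) (m := k + 1) (by omega)
    (by rw [hm2, hF1]; exact dvd_mul_left _ _)
  have h2 : (2 : F) ≠ 0 := by
    intro h
    have h2' : p ∣ 2 := (CharP.cast_eq_zero_iff F p 2).1 (by exact_mod_cast h)
    have hp2 : p = 2 := (Nat.prime_dvd_prime_iff_eq Fact.out Nat.prime_two).1 h2'
    have hs : s ≠ 0 := by rintro rfl; simp at hps; omega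
    have : 2 ∣ n := by rw [hps, hp2]; exact dvd_pow_self _ hs
    omega
  have hfrob : ∀ x y : F, (x - y) ^ n = x ^ n - y ^ n := fun x y => by
    rw [hps]; exact sub_pow_char_pow x y s
  have hxx : ∀ x : F, (x ^ n) ^ n = x := fun x => by
    rw [← pow_mul, ← sq, ← hF]; exact FiniteField.pow_card x
  have hroot : ∀ u ∈ T, ∑ t ∈ A.powersetCard j, ∏ x ∈ t, (x ^ n - u * x) = 0 := by
    intro u hu
    have hu1 : u ^ n * u = 1 := by
      rw [← pow_succ, ← hm2, mul_comm, pow_mul, hTu u hu]; norm_num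
    -- A collision gives u = (x - y)^(n-1); as x - y is a square, u^((n+1)/2) = 1, not -1.
    have hinj : Set.InjOn (fun x => x ^ n - u * x) (A : Set F) := by
      intro x hx y hy hxy
      by_contra hne
      have hne' : x - y ≠ 0 := sub_ne_zero.2 hne
      have h1 : (x - y) ^ n = u * (x - y) := by
        rw [hfrob]; linear_combination hxy
      have h3 : (x - y) ^ (n - 1) = u := by
        apply mul_right_cancel₀ hne'
        rw [← pow_succ, Nat.sub_add_cancel hn.le, h1]
      obtain ⟨z, hz⟩ := hsq x hx y hy
      have hz0 : z ≠ 0 := by rintro rfl; simp [hz] at hne'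
      have h4 : u ^ (k + 1) = 1 := by
        rw [← h3, hz, ← pow_mul, ← sq, ← pow_mul]
        have : 2 * ((n - 1) * (k + 1)) = Fintype.card F - 1 := by
          rw [hF1, ← hm2]; ring
        rw [this]; exact FiniteField.pow_card_sub_one_eq_one z hz0
      rw [hTu u hu] at h4
      exact h2 (by linear_combination -h4)
    have hprod := prod_X_add_C_eq_of_injOn hn hA hinj (c := u ^ n) (fun x _ => by
      have ho : Odd n := ⟨k, hk⟩
      rw [ho.neg_pow, hfrob, mul_pow, hxx]
      linear_combination x * hu1)
    -- As j ≤ n/2, the exponent n - j avoids both n and 1.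
    have hc := congrArg (fun P => P.coeff (n - j)) hprod
    beta_reduce at hc
    rw [prod_X_add_C_coeff _ _ (by omega), hA, Nat.sub_sub_self (by omega)] at hc
    rw [hc, coeff_add, coeff_X_pow, coeff_C_mul, coeff_X, if_neg (by omega), if_neg (by omega),
      mul_zero, add_zero]
  -- Let u vary: Q has degree at most j but (n+1)/2 > j roots, so it vanishes. Its coefficient of
  -- degree j is ±e_j(A).
  set Q : F[X] := ∑ t ∈ A.powersetCard j, ∏ x ∈ t, (C (x ^ n) + C (-x) * X) with hQ
  have hlin : ∀ a b : F, (C a + C b * X).natDegree ≤ 1 := fun a b => by compute_degree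
  have hdeg : Q.natDegree ≤ j := by
    refine natDegree_sum_le_of_forall_le _ _ fun t ht => ?_
    refine (natDegree_prod_le _ _).trans ?_
    rw [← (mem_powersetCard.1 ht).2, card_eq_sum_ones]
    exact sum_le_sum fun x _ => hlin _ _
  have hQ0 : Q = 0 := by
    refine eq_zero_of_degree_lt_of_eval_finset_eq_zero T ?_ fun u hu => ?_
    · rw [hT]
      exact (natDegree_le_iff_degree_le.1 hdeg).trans_lt (by exact_mod_cast (by omega : j < k + 1))
    · rw [hQ, eval_finsetSum, ← hroot u hu]
      refine sum_congr rfl fun t _ => ?_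
      rw [eval_prod]
      refine prod_congr rfl fun x _ => ?_
      simp only [eval_add, eval_C, eval_mul, eval_X]
      ring
  have hcoeff : Q.coeff j = (-1) ^ j * ∑ t ∈ A.powersetCard j, ∏ x ∈ t, x := by
    rw [hQ, finsetSum_coeff, mul_sum]
    refine sum_congr rfl fun t ht => ?_
    have := coeff_prod_of_natDegree_le (s := t) (fun x : F => C (x ^ n) + C (-x) * X) 1
      fun x _ => hlin _ _
    rw [mul_one, (mem_powersetCard.1 ht).2] at this
    rw [this, ← (mem_powersetCard.1 ht).2, ← prod_neg]
    refine prod_congr rfl fun x _ => ?_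
    rw [coeff_add, coeff_C, coeff_C_mul, coeff_X_one]
    simp
  rw [hQ0, coeff_zero] at hcoeff
  simpa using hcoeff.symm

open Finset in
theorem sum_powersetCard_prod_erase_zero {R : Type*} [CommSemiring R] [DecidableEq R]
    (A : Finset R) (j : ℕ) :
    ∑ t ∈ (A.erase 0).powersetCard j, ∏ x ∈ t, x = ∑ t ∈ A.powersetCard j, ∏ x ∈ t, x := by
  refine sum_subset (powersetCard_mono (erase_subset _ _)) fun t ht hnt => ?_
  by_contra hne
  refine hnt (mem_powersetCard.2 ⟨fun x hx => mem_erase.2 ⟨?_, ?_⟩, (mem_powersetCard.1 ht).2⟩)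
  · rintro rfl
    exact hne (prod_eq_zero hx rfl)
  · exact (mem_powersetCard.1 ht).1 hx

open Finset in
theorem sum_powersetCard_prod_inv {F : Type*} [Field F] [DecidableEq F]
    {B : Finset F} (hB : (0 : F) ∉ B) {j : ℕ} (hj : j ≤ #B) :
    ∑ t ∈ B.powersetCard (#B - j), ∏ x ∈ t, x =
      (∏ x ∈ B, x) * ∑ t ∈ B.powersetCard j, ∏ x ∈ t, x⁻¹ := by
  rw [mul_sum]
  refine sum_nbij' (fun t => B \ t) (fun t => B \ t) ?_ ?_ ?_ ?_ ?_
  · intro t ht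
    rw [mem_powersetCard] at ht ⊢
    refine ⟨sdiff_subset, ?_⟩
    rw [card_sdiff_of_subset ht.1, ht.2]; omega
  · intro t ht
    rw [mem_powersetCard] at ht ⊢
    refine ⟨sdiff_subset, ?_⟩
    rw [card_sdiff_of_subset ht.1, ht.2]
  · intro t ht
    exact Finset.sdiff_sdiff_eq_self (mem_powersetCard.1 ht).1
  · intro t ht
    exact Finset.sdiff_sdiff_eq_self (mem_powersetCard.1 ht).1
  · intro t ht
    have hne : ∏ x ∈ B \ t, x ≠ 0 :=
      prod_ne_zero_iff.2 fun x hx h0 => hB (h0 ▸ (mem_sdiff.1 hx).1)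
    rw [← prod_sdiff (mem_powersetCard.1 ht).1, prod_inv_distrib]
    field_simp

open Finset Polynomial in
/-- Blokhuis: a set of `√q` elements with square differences that contains `0` and `1` is fixed
pointwise by the involution `x ↦ x ^ √q`. -/
theorem pow_eq_self_of_isSquare_sub {F : Type*} [Field F] [Fintype F] {p s n : ℕ} [CharP F p]
    [Fact p.Prime] (hps : n = p ^ s) (hn : 1 < n) (hodd : Odd n) (hF : Fintype.card F = n ^ 2)
    {A : Finset F} (hA : #A = n) (h0 : (0 : F) ∈ A) (h1 : (1 : F) ∈ A)
    (hsq : ∀ x ∈ A, ∀ y ∈ A, IsSquare (x - y)) {x : F} (hx : x ∈ A) : x ^ n = x := by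
  classical
  have hInj : Function.Injective (fun x : F => x⁻¹) := inv_injective
  set B := A.erase 0 with hBdef
  have hB0 : (0 : F) ∉ B := by simp [hBdef]
  have hB : #B = n - 1 := by rw [hBdef, card_erase_of_mem h0, hA]
  have hlow : ∀ j, 0 < j → j ≤ n / 2 → ∑ t ∈ B.powersetCard j, ∏ x ∈ t, x = 0 := by
    intro j hj hjn
    rw [hBdef, sum_powersetCard_prod_erase_zero]
    exact sum_powersetCard_prod_eq_zero hps hn hodd hF hA hsq hj hjn
  have hinv : ∀ j, 0 < j → j ≤ n / 2 → ∑ t ∈ B.powersetCard j, ∏ x ∈ t, x⁻¹ = 0 := by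
    intro j hj hjn
    -- Inversion keeps differences square: 1/x - 1/y = (y - x)/(xy), and x = x - 0, y = y - 0 are
    -- squares.
    have hsq' : ∀ x ∈ A.image (·⁻¹), ∀ y ∈ A.image (·⁻¹), IsSquare (x - y) := by
      simp only [mem_image, forall_exists_index, and_imp, forall_apply_eq_imp_iff₂]
      intro x hx y hy
      rcases eq_or_ne x 0 with rfl | hx0
      · have : (0 : F)⁻¹ - y⁻¹ = (0 - y)⁻¹ := by simp [inv_neg]
        rw [this]; exact (hsq 0 hx y hy).inv
      rcases eq_or_ne y 0 with rfl | hy0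
      · have : x⁻¹ - (0 : F)⁻¹ = (x - 0)⁻¹ := by simp
        rw [this]; exact (hsq x hx 0 hy).inv
      have : x⁻¹ - y⁻¹ = (y - x) * ((x - 0)⁻¹ * (y - 0)⁻¹) := by
        rw [sub_zero, sub_zero]; field_simp
      rw [this]
      exact (hsq y hy x hx).mul ((hsq x hx 0 h0).inv.mul (hsq y hy 0 h0).inv)
    have h := sum_powersetCard_prod_eq_zero hps hn hodd hF
      ((card_image_of_injective A hInj).trans hA) hsq' hj hjn
    have himg : (A.image (·⁻¹)).erase 0 = B.image (·⁻¹) := by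
      rw [hBdef, image_erase hInj, inv_zero]
    rw [← sum_powersetCard_prod_erase_zero, himg, show B.image (·⁻¹) = B.map ⟨_, hInj⟩ from (map_eq_image ⟨_, hInj⟩ B).symm,
      powersetCard_map, sum_map] at h
    rw [← h]
    refine sum_congr rfl fun t _ => ?_
    simp [mapEmbedding_apply]
  have hpoly : ∏ x ∈ B, (X + C x) = X ^ (n - 1) + C (∏ x ∈ B, x) := by
    ext k
    rw [coeff_add, coeff_X_pow, coeff_C]
    rcases lt_or_ge #B k with hk | hk
    · rw [coeff_eq_zero_of_natDegree_lt, if_neg (by omega), if_neg (by omega), add_zero]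
      rw [natDegree_prod_of_monic _ _ fun x _ => monic_X_add_C _]
      simpa using hk
    rw [prod_X_add_C_coeff _ _ hk]
    rcases eq_or_ne k 0 with rfl | hk0
    · rw [Nat.sub_zero, powersetCard_self, sum_singleton, if_neg (by omega), if_pos rfl, zero_add]
    rcases eq_or_ne k (n - 1) with rfl | hk1
    · rw [hB, Nat.sub_self, powersetCard_zero, sum_singleton, if_pos rfl, if_neg hk0]
      simp
    rw [if_neg hk1, if_neg hk0, add_zero]
    -- The coefficient is e_(n-1-k): low k uses the inverses, high k uses A itself.
    rcases le_or_gt k (n / 2) with hk2 | hk2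
    · rw [sum_powersetCard_prod_inv hB0 hk, hinv k (by omega) hk2, mul_zero]
    · exact hlow _ (by omega) (by omega)
  have hev : ∀ y ∈ B, y ^ (n - 1) + ∏ x ∈ B, x = 0 := by
    intro y hy
    have h := congrArg (eval (-y)) hpoly
    have he : Even (n - 1) := by
      obtain ⟨k, rfl⟩ := hodd
      simp
    rw [eval_prod, prod_eq_zero hy (by simp)] at h
    simpa only [eval_add, eval_pow, eval_X, eval_C, he.neg_pow] using h.symm
  rcases eq_or_ne x 0 with rfl | hx0
  · exact zero_pow (by omega)
  have hx1 := hev x (mem_erase.2 ⟨hx0, hx⟩)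
  have h11 := hev 1 (mem_erase.2 ⟨one_ne_zero, h1⟩)
  have : x ^ (n - 1) = 1 := by
    rw [one_pow] at h11
    linear_combination hx1 - h11
  rw [← Nat.sub_add_cancel hn.le, pow_succ, this, one_mul]

/-! ### Character sums -/

open Finset ComplexConjugate in
theorem sum_conj_mul_sum_addChar {F : Type*} [Field F] [Fintype F] (ψ : AddChar F ℂ)
    (A : Finset F) (c : F) :
    (∑ a ∈ A, ψ (a * c)) * conj (∑ a ∈ A, ψ (a * c)) = ∑ a ∈ A, ∑ b ∈ A, ψ (c * (a - b)) := by
  rw [map_sum, sum_mul_sum]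
  refine sum_congr rfl fun a _ => sum_congr rfl fun b _ => ?_
  rw [← AddChar.map_neg_eq_conj, ← AddChar.map_add_eq_mul]
  congr 1
  ring

open Finset ComplexConjugate in
theorem sum_addChar_mul_conj {F : Type*} [Field F] [Fintype F] {ψ : AddChar F ℂ}
    (hψ : ψ.IsPrimitive) (A : Finset F) :
    ∑ c : F, (∑ a ∈ A, ψ (a * c)) * conj (∑ a ∈ A, ψ (a * c)) = Fintype.card F * #A := by
  classical
  simp_rw [sum_conj_mul_sum_addChar]
  rw [sum_comm]
  simp_rw [sum_comm (s := univ)]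
  rw [sum_congr rfl fun a ha => sum_congr rfl fun b _ => AddChar.sum_mulShift (a - b) hψ]
  have hite : ∀ a ∈ A, ∑ b ∈ A, (((if a - b = 0 then Fintype.card F else 0 : ℕ)) : ℂ) =
      Fintype.card F := by
    intro a ha
    simp only [sub_eq_zero, apply_ite (Nat.cast (R := ℂ)), Nat.cast_zero]
    rw [sum_ite_eq, if_pos ha]
  rw [sum_congr rfl hite]
  simp [mul_comm]

-- Expand |S(c)|² and sum over c first: the twisted Gauss sum at d = a - b is χ(d) times the Gauss
-- sum, also at d = 0 because χ is nontrivial.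
open Finset ComplexConjugate in
theorem sum_mulChar_mul_gaussSum {F : Type*} [Field F] [Fintype F] {χ : MulChar F ℂ}
    (hχ : χ ≠ 1) (hχ2 : χ.IsQuadratic) (ψ : AddChar F ℂ) (A : Finset F) :
    (∑ a ∈ A, ∑ b ∈ A, χ (a - b)) * gaussSum χ ψ =
      ∑ c : F, χ c * ((∑ a ∈ A, ψ (a * c)) * conj (∑ a ∈ A, ψ (a * c))) := by
  have hshift : ∀ d : F, χ d * gaussSum χ ψ = ∑ c : F, χ c * ψ (c * d) := by
    intro d
    rcases eq_or_ne d 0 with rfl | hd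
    · simp [MulChar.sum_eq_zero_of_ne_one hχ, MulChar.map_zero]
    · have h := gaussSum_mulShift_eq χ ψ (Units.mk0 d hd)
      rw [hχ2.inv, Units.val_mk0] at h
      rw [← h, gaussSum]
      simp only [AddChar.mulShift_apply, mul_comm d]
  simp_rw [sum_conj_mul_sum_addChar, sum_mul, hshift, mul_sum]
  rw [sum_comm (s := univ)]
  refine sum_congr rfl fun a _ => ?_
  rw [sum_comm]

open Finset in
theorem eq_of_sum_sum_eq {ι : Type*} {A : Finset ι} {f : ι → ι → ℤ} (hf0 : ∀ a, f a a = 0)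
    (hf1 : ∀ a b, f a b ≤ 1) (hsum : ∑ a ∈ A, ∑ b ∈ A, f a b = (#A : ℤ) ^ 2 - #A) {a b : ι}
    (ha : a ∈ A) (hb : b ∈ A) (hab : a ≠ b) : f a b = 1 := by
  classical
  have hle : ∀ a b, f a b ≤ if a = b then 0 else 1 := by
    intro a b
    split_ifs with h
    · rw [h, hf0]
    · exact hf1 a b
  have htot : ∑ a ∈ A, ∑ b ∈ A, (if a = b then (0 : ℤ) else 1) = (#A : ℤ) ^ 2 - #A := by
    have : ∀ a b : ι, (if a = b then (0 : ℤ) else 1) = 1 - if a = b then 1 else 0 := by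
      intro a b; split_ifs <;> simp
    simp_rw [this, sum_sub_distrib]
    rw [sum_congr (s₂ := A) (f := fun a => ∑ b ∈ A, if a = b then (1 : ℤ) else 0) rfl fun a ha => by
      rw [sum_ite_eq, if_pos ha]]
    simp [sq]
  have h1 := (sum_eq_sum_iff_of_le fun a _ => sum_le_sum fun b _ => hle a b).1
    (hsum.trans htot.symm) a ha
  have h2 := (sum_eq_sum_iff_of_le fun b _ => hle a b).1 h1 b hb
  rwa [if_neg hab] at h2

open Finset ComplexConjugate in
theorem isSquare_sub_of_sum_addChar_eq_zero {F : Type*} [Field F] [Fintype F] [DecidableEq F]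
    {n : ℕ} (hn : 1 < n) (hF2 : ringChar F ≠ 2) (hF : Fintype.card F = n ^ 2) {ψ : AddChar F ℂ}
    (hψ : ψ.IsPrimitive) {A : Finset F} (hA : #A = n) (h0 : (0 : F) ∈ A) (h1 : (1 : F) ∈ A)
    {ε : ℤ} (hε : ε ^ 2 = 1)
    (hS : ∀ c : F, c ≠ 0 → quadraticChar F c ≠ ε → ∑ a ∈ A, ψ (a * c) = 0) :
    ∀ x ∈ A, ∀ y ∈ A, IsSquare (x - y) := by
  set χ : MulChar F ℂ := (quadraticChar F).ringHomComp (Int.castRingHom ℂ) with hχdef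
  have hχ1 : χ ≠ 1 :=
    (MulChar.ringHomComp_ne_one_iff (RingHom.injective_int _)).2 (quadraticChar_ne_one hF2)
  have hχ2 : χ.IsQuadratic := (quadraticChar_isQuadratic F).comp _
  have hχa : ∀ c, χ c = (quadraticChar F c : ℂ) := fun c => by simp [hχdef]
  set M : ℤ := ∑ a ∈ A, ∑ b ∈ A, quadraticChar F (a - b) with hM
  have hkey := sum_mulChar_mul_gaussSum hχ1 hχ2 ψ A
  have hMc : ∑ a ∈ A, ∑ b ∈ A, χ (a - b) = (M : ℂ) := by
    rw [hM]; push_cast; simp only [hχa]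
  -- Where S(c) ≠ 0 and c ≠ 0, χ(c) = ε; at c = 0, S = n while χ = 0, hence the correction.
  have hterm : ∀ c : F, χ c * ((∑ a ∈ A, ψ (a * c)) * conj (∑ a ∈ A, ψ (a * c))) =
      (ε : ℂ) * ((∑ a ∈ A, ψ (a * c)) * conj (∑ a ∈ A, ψ (a * c))) -
        if c = 0 then (ε : ℂ) * (n : ℂ) ^ 2 else 0 := by
    intro c
    split_ifs with hc
    · subst hc; simp [hA, sq, MulChar.map_zero]
    · rw [sub_zero]
      by_cases h : quadraticChar F c = ε
      · rw [hχa, h]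
      · rw [hS c hc h]; simp
  rw [hMc, sum_congr rfl fun c _ => hterm c, sum_sub_distrib, ← mul_sum, sum_addChar_mul_conj hψ,
    sum_ite_eq' univ, if_pos (mem_univ _), hF, hA] at hkey
  have hG := gaussSum_sq hχ1 hχ2 hψ
  rw [hF, hχa] at hG
  have hn0 : (n : ℤ) ≠ 0 := by omega
  -- Squaring avoids the sign of the Gauss sum.
  have hsqZ : M ^ 2 * quadraticChar F (-1) = ((n : ℤ) ^ 2 - n) ^ 2 := by
    have hεC : (ε : ℂ) ^ 2 = 1 := by exact_mod_cast hε
    have hkey2 : (M : ℂ) ^ 2 * (quadraticChar F (-1) : ℂ) * (n : ℂ) ^ 2 =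
        ((n : ℂ) ^ 2 - n) ^ 2 * (n : ℂ) ^ 2 := by
      have := congrArg (· ^ 2) hkey
      simp only [mul_pow, hG] at this
      push_cast at this
      linear_combination this + (n : ℂ) ^ 4 * ((n : ℂ) - 1) ^ 2 * hεC
    have hkeyZ : M ^ 2 * quadraticChar F (-1) * (n : ℤ) ^ 2 =
        ((n : ℤ) ^ 2 - n) ^ 2 * (n : ℤ) ^ 2 := by exact_mod_cast hkey2
    exact mul_right_cancel₀ (pow_ne_zero 2 hn0) hkeyZ
  have hNpos : (0 : ℤ) < ((n : ℤ) ^ 2 - n) ^ 2 := by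
    have : (1 : ℤ) < n := by exact_mod_cast hn
    have : (0 : ℤ) < (n : ℤ) ^ 2 - n := by nlinarith
    positivity
  have hMsq : M ^ 2 = ((n : ℤ) ^ 2 - n) ^ 2 := by
    rcases quadraticChar_dichotomy (F := F) (a := -1) (by simp) with h | h
    · rwa [h, mul_one] at hsqZ
    · rw [h] at hsqZ
      nlinarith [sq_nonneg M]
  have hle : ∀ c : F, quadraticChar F c ≤ 1 ∧ -quadraticChar F c ≤ 1 := by
    intro c
    rcases quadraticChar_isQuadratic F c with h | h | h <;> simp [h]
  have hall : ∀ x ∈ A, ∀ y ∈ A, x ≠ y → quadraticChar F (x - y) = 1 := by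
    rcases sq_eq_sq_iff_eq_or_eq_neg.1 hMsq with h | h
    · intro x hx y hy hxy
      exact eq_of_sum_sum_eq (f := fun a b => quadraticChar F (a - b)) (by simp)
        (fun a b => (hle _).1) (by rw [hA]; exact h) hx hy hxy
    -- The negative value of M would make 1 - 0 a non-square.
    · have := eq_of_sum_sum_eq (A := A) (f := fun a b => -quadraticChar F (a - b)) (by simp)
        (fun a b => (hle _).2) (by simp only [sum_neg_distrib]; rw [hA, ← hM, h, neg_neg])
        h1 h0 one_ne_zero
      simp at this
  intro x hx y hy
  rcases eq_or_ne x y with rfl | hxy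
  · simp
  · exact (quadraticChar_one_iff_isSquare (sub_ne_zero.2 hxy)).1 (hall x hx y hy hxy)

/-- The additive character `x ↦ e_p (Tr x)` of a finite field. -/
noncomputable def traceAddChar (p : ℕ) [Fact p.Prime] (F : Type*) [Field F] [Algebra (ZMod p) F] :
    AddChar F ℂ :=
  ZMod.stdAddChar.compAddMonoidHom (Algebra.trace (ZMod p) F).toAddMonoidHom

theorem traceAddChar_isPrimitive (p : ℕ) [Fact p.Prime] (F : Type*) [Field F] [Finite F]
    [Algebra (ZMod p) F] : (traceAddChar p F).IsPrimitive := by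
  refine AddChar.IsPrimitive.of_ne_one (AddChar.ne_one_iff.2 ?_)
  obtain ⟨a, ha⟩ := Algebra.trace_surjective (ZMod p) F 1
  refine ⟨a, fun h => ?_⟩
  have h' : ZMod.stdAddChar (1 : ZMod p) = (ZMod.stdAddChar (0 : ZMod p) : ℂ) := by
    rw [AddChar.map_zero_eq_one, ← ha]
    exact h
  exact one_ne_zero (ZMod.injective_stdAddChar h')

-- X^(p^s) - X has at most p^s roots, so A is all of them: the fixed field of the s-fold Frobenius.
open Finset Polynomial in
theorem exists_subfield_of_pow_eq_self {F : Type*} [Field F] [Finite F] {p s : ℕ} [Fact p.Prime]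
    [CharP F p] (hs : 1 < p ^ s) {A : Finset F} (hA : #A = p ^ s)
    (hfix : ∀ x ∈ A, x ^ p ^ s = x) :
    ∃ K : Subfield F, Nat.card K = p ^ s ∧ (A : Set F) = (K : Set F) := by
  classical
  have hroots : A = (X ^ p ^ s - X : F[X]).roots.toFinset := by
    refine eq_of_subset_of_card_le (fun x hx => ?_) ?_
    · rw [Multiset.mem_toFinset, mem_roots (FiniteField.X_pow_card_sub_X_ne_zero F hs)]
      simp [hfix x hx]
    · rw [hA]
      exact (Multiset.toFinset_card_le _).trans ((card_roots' _).trans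
        (FiniteField.X_pow_card_sub_X_natDegree_eq F hs).le)
  have hK : (A : Set F) = (iterateFrobenius F p s).eqLocusField (RingHom.id F) := by
    ext x
    rw [hroots, mem_coe, Multiset.mem_toFinset,
      mem_roots (FiniteField.X_pow_card_sub_X_ne_zero F hs)]
    change _ ↔ x ^ p ^ s = x
    simp [sub_eq_zero]
  refine ⟨_, ?_, hK⟩
  change Nat.card ((iterateFrobenius F p s).eqLocusField (RingHom.id F) : Set F) = _
  rw [← hK, ← hA]
  simp

theorem corollary3p4 (p s : ℕ) [Fact p.Prime] (F : Type*) [Field F] [Finite F]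
    [Algebra (ZMod p) F] (hF : Nat.card F = p ^ (2 * s)) (A : Finset F)
    (h0 : (0 : F) ∈ A) (h1 : (1 : F) ∈ A) (hA : A.card = p ^ s)
    (hS : (p ^ s % 4 = 1 ∧ ∀ c : F, c ≠ 0 → IsSquare c → expSum p A c = 0) ∨
      (p ^ s % 4 = 3 ∧ ∀ c : F, c ≠ 0 → ¬ IsSquare c → expSum p A c = 0)) :
    ∃ K : Subfield F, Nat.card K = p ^ s ∧ (A : Set F) = (K : Set F) := by
  classical
  have := Fintype.ofFinite F
  have hchar : CharP F p := charP_of_injective_algebraMap (algebraMap (ZMod p) F).injective p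
  have hF' : Fintype.card F = (p ^ s) ^ 2 := by
    rw [← Nat.card_eq_fintype_card, hF, ← pow_mul, mul_comm]
  have hn : 1 < p ^ s := by
    have := Fintype.one_lt_card (α := F)
    rw [hF'] at this
    by_contra hle
    have : p ^ s ≤ 1 := by omega
    have := Nat.pow_le_pow_left this 2
    omega
  have hodd : Odd (p ^ s) := by
    rw [Nat.odd_iff]
    rcases hS with h | h <;> omega
  have hp2 : ringChar F ≠ 2 := by
    rw [ringChar.eq F p]
    rintro rfl
    have hs : s ≠ 0 := by rintro rfl; simp at hn
    exact (Nat.not_even_iff_odd.2 hodd) (even_two.pow_of_ne_zero hs)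
  have hsq : ∀ x ∈ A, ∀ y ∈ A, IsSquare (x - y) := by
    rcases hS with ⟨-, hS⟩ | ⟨-, hS⟩
    -- ε names the class where S may survive, opposite to the one where it vanishes.
    · refine isSquare_sub_of_sum_addChar_eq_zero hn hp2 hF' (traceAddChar_isPrimitive p F) hA h0 h1
        (ε := -1) (by norm_num) fun c hc h => hS c hc ?_
      rwa [Ne, quadraticChar_neg_one_iff_not_isSquare, not_not] at h
    · refine isSquare_sub_of_sum_addChar_eq_zero hn hp2 hF' (traceAddChar_isPrimitive p F) hA h0 h1
        (ε := 1) (by norm_num) fun c hc h => hS c hc ?_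
      rwa [Ne, quadraticChar_one_iff_isSquare hc] at h
  exact exists_subfield_of_pow_eq_self hn hA fun x hx =>
    pow_eq_self_of_isSquare_sub rfl hn hodd hF' hA h0 h1 hsq hx
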